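/- Let $0<\alpha<2$ and let $\mu$ be a probability law on $\mathbb{R}$, not necessarily symmetric, with $\mu(\{0\})=0$, that is regularly varying with index $\alpha$: $\mu(\{y:|y|\ge x\})\sim L(x)x^{-\alpha}$ as $x\to\infty$ for some function $L$ with $\lim_{x\to\infty}L(ax)/L(x)=1$ for every $a>0$. For $p\ge 1$ let $\mu_{\alpha,p}$ (the $\alpha$-spherical distribution generated by $\mu$) be the law on the unit sphere $\mathbb{S}^{p-1}\subset\mathbb{R}^p$ of $$\Big(\tfrac{\xi_1}{\sqrt{\sum_{k=1}^p \xi_k^2}},\dots,\tfrac{\xi_p}{\sqrt{\sum_{k=1}^p \xi_k^2}}\Big),\qquad \xi_1,\dots,\xi_p \text{ i.i.d. with law } \mu .$$ Let $p=p_n\to\infty$ with $p_n=o(n^2)$ as $n\to\infty$, where $\alpha$ and $\mu$ do not depend on $n$. (a) For each $n$ let $X_1,\dots,X_n$ (depending on $n$) be i.i.d. with law $\mu_{\alpha,p_n}$. Then $$\max_{1\le i<j\le n} X_i^{\top}X_j \longrightarrow 1\quad\text{in probability as } n\to\infty .$$ (b) Equivalently, for each $n$ let $Z=(Z_{ik})_{1\le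 i\le n,\,1\le k\le p_n}$ have i.i.d. entries with law $\mu$. Then the largest off-diagonal entry of the (uncentred) sample correlation matrix, $$\max_{1\le i<j\le n}\frac{\sum_{k}Z_{ik}Z_{jk}}{\sqrt{\sum_k Z_{ik}^2}\,\sqrt{\sum_k Z_{jk}^2}},$$ converges to $1$ in probability as $n\to\infty$. (c) Consequently the packing test is consistent against $\mu_{\alpha,p_n}$: if moreover $\log n=o(p_n)$ (in particular if $(\log n)^2=o(p_n)$), then in the setting of (a) the statistic $P_n=p_n\max_{1\le i<j\le n}(X_i^{\top}X_j)^2-4\log n+\log\log n$ satisfies $\mathbb{P}(P_n>c)\to 1$ for every fixed critical value $c\in\mathbb{R}$. -/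

import Mathlib

open MeasureTheory ProbabilityTheory Filter Topology Asymptotics

namespace HeavyTailPacking

/-- `L` is slowly varying at infinity: `L (a x) / L x → 1` as `x → ∞`, for every `a > 0`.
(The case `a = 1` forces `L` to be eventually nonzero.) -/
def SlowlyVarying (L : ℝ → ℝ) : Prop :=
  ∀ a : ℝ, 0 < a → Tendsto (fun x => L (a * x) / L x) atTop (𝓝 1)

/-- The law `μ` on the real line is regularly varying with index `α`:
`μ {y : |y| ≥ x} ~ L(x) x ^ (-α)` as `x → ∞`, for some slowly varying `L`.
Nothing is required of the balance between the left and the right tail. -/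
def RegularlyVaryingTail (μ : Measure ℝ) (α : ℝ) : Prop :=
  ∃ L : ℝ → ℝ, SlowlyVarying L ∧
    (fun x : ℝ => μ.real {y : ℝ | x ≤ |y|}) ~[atTop] (fun x : ℝ => L x * x ^ (-α))

/-- The vector `(x₁, …, x_p) / √(x₁² + ⋯ + x_p²)` of Euclidean space. -/
noncomputable def sphereProj {p : ℕ} (x : Fin p → ℝ) : EuclideanSpace ℝ (Fin p) :=
  WithLp.toLp 2 (fun k => x k / √(∑ l, x l ^ 2))

/-- The law of the projection to the unit sphere of a vector with `p` i.i.d. coordinates of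
law `μ`. If `μ` is regularly varying with index `α ∈ (0, 2)` and has no atom at `0`, this is
the `α`-spherical distribution in dimension `p` generated by `μ`. -/
noncomputable def sphericalLaw (μ : Measure ℝ) (p : ℕ) : Measure (EuclideanSpace ℝ (Fin p)) :=
  (Measure.pi (fun _ : Fin p => μ)).map sphereProj

/-- The maximum of `a i j` over all pairs `i < j` (the index set is finite; it is nonempty
as soon as `n ≥ 2`). -/
noncomputable def maxPairs {n : ℕ} (a : Fin n → Fin n → ℝ) : ℝ :=
  ⨆ q : {q : Fin n × Fin n // q.1 < q.2}, a q.1.1 q.1.2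

/-- The packing statistic
`p * max_{i<j} (x_iᵀ x_j)² - 4 log n + log log n` of `n` points of `p`-dimensional space. -/
noncomputable def packingStatistic {n p : ℕ} (x : Fin n → EuclideanSpace ℝ (Fin p)) : ℝ :=
  (p : ℝ) * maxPairs (fun i j => (inner ℝ (x i) (x j)) ^ 2)
    - 4 * Real.log n + Real.log (Real.log n)

/-- The (uncentred) sample correlation matrix of the rows `z i`: its `(i, j)` entry is
`(∑ₖ z_ik z_jk) / (√(∑ₖ z_ik²) √(∑ₖ z_jk²))`. -/
noncomputable def sampleCorr {n p : ℕ} (z : Fin n → Fin p → ℝ) : Matrix (Fin n) (Fin n) ℝ :=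
  Matrix.of fun i j => (∑ k, z i k * z j k) / (√(∑ k, z i k ^ 2) * √(∑ k, z j k ^ 2))

/-- Convergence in probability to the constant `c`, where the `n`-th variable lives on a
probability space of its own. -/
def TendstoInProbability {Ω : ℕ → Type*} [∀ n, MeasurableSpace (Ω n)]
    (P : ∀ n, Measure (Ω n)) (Y : ∀ n, Ω n → ℝ) (c : ℝ) : Prop :=
  ∀ ε : ℝ, 0 < ε → Tendsto (fun n => P n {ω | ε ≤ |Y n ω - c|}) atTop (𝓝 0)

end HeavyTailPacking

/-! The result is a birthday paradox. A tail of index below two lets a single coordinate dominate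
the Euclidean norm: at a level `x` whose tail is of order `1 / p`, the other coordinates together
contribute only a small multiple of `x ^ 2` with probability at least `1 / 2` (`exists_level`,
`half_mul_le_measureReal_dominant`). Hence, for one sign `s`, each of the `p` vertices `s e_k` of
the cross-polytope has a small ball of spherical mass at least `b / p` (`exists_vertex_mass`).

These balls are disjoint cells. The expected number of pairs of sample points sharing a cell is at
least of order `n ^ 2 * p * (b / p) ^ 2 = b ^ 2 * n ^ 2 / p`, which diverges when `p = o(n ^ 2)`;
`measureReal_no_collision_le` makes a collision likely without a second moment computation. Two
points in one cell have inner product close to `1`, the upper bound `1` is Cauchy–Schwarz, and (b)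
and (c) follow from this. -/

namespace HeavyTailPacking

/-! ### Regularly varying tails and truncated second moments -/

/-- Along a regularly varying tail of index less than two, doubling the argument costs a factor
that is eventually bounded below by a constant larger than `1/4`. -/
theorem RegularlyVaryingTail.exists_doubling {μ : Measure ℝ} {α : ℝ} (hα2 : α < 2)
    (hμ : RegularlyVaryingTail μ α) :
    ∃ ρ : ℝ, 1 / 4 < ρ ∧ ∃ x₀ : ℝ, 0 < x₀ ∧ ∀ x, x₀ ≤ x →
      0 < μ.real {y : ℝ | x ≤ |y|} ∧
        ρ * μ.real {y : ℝ | x ≤ |y|} ≤ μ.real {y : ℝ | 2 * x ≤ |y|} := by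
  obtain ⟨L, hL, hG⟩ := hμ
  set G : ℝ → ℝ := fun x => μ.real {y : ℝ | x ≤ |y|} with hGdef
  have hLne : ∀ᶠ x in atTop, L x ≠ 0 := by
    have h1 := (hL 1 one_pos).eventually_ne one_ne_zero
    filter_upwards [h1] with x hx h0
    simp [h0] at hx
  have hvne : ∀ᶠ x : ℝ in atTop, L x * x ^ (-α) ≠ 0 := by
    filter_upwards [hLne, eventually_gt_atTop 0] with x hx hx0
    exact mul_ne_zero hx (Real.rpow_pos_of_pos hx0 _).ne'
  have hq : Tendsto (fun x => G x / (L x * x ^ (-α))) atTop (𝓝 1) :=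
    (isEquivalent_iff_tendsto_one hvne).1 hG
  have hGne : ∀ᶠ x in atTop, G x ≠ 0 := by
    filter_upwards [hq.eventually_ne one_ne_zero] with x hx h0
    simp [h0] at hx
  have h2 : Tendsto (fun x : ℝ => 2 * x) atTop atTop :=
    tendsto_id.const_mul_atTop two_pos
  have hratio : Tendsto (fun x => G (2 * x) / G x) atTop (𝓝 ((2 : ℝ) ^ (-α))) := by
    have h := (((hq.comp h2).mul (hL 2 two_pos)).mul (hq.inv₀ one_ne_zero)).mul
      (tendsto_const_nhds (x := (2 : ℝ) ^ (-α)))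
    simp only [one_mul, inv_one] at h
    refine h.congr' ?_
    filter_upwards [hLne, h2.eventually hLne, hGne, eventually_gt_atTop 0] with x h1 h2 h3 hx0
    have hxp := (Real.rpow_pos_of_pos hx0 (-α)).ne'
    have h2p := (Real.rpow_pos_of_pos (two_pos (α := ℝ)) (-α)).ne'
    simp only [Function.comp]
    rw [Real.mul_rpow two_pos.le hx0.le]
    field_simp
  -- This is where `α < 2` enters: under doubling, `x ^ 2` times the tail grows by a factor bounded
  -- away from `1`.
  have hquarter : (1 / 4 : ℝ) < 2 ^ (-α) := by
    have : (2 : ℝ) ^ (-2 : ℝ) < 2 ^ (-α) :=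
      Real.rpow_lt_rpow_of_exponent_lt one_lt_two (by linarith)
    have h4 : (2 : ℝ) ^ (-2 : ℝ) = 1 / 4 := by
      rw [Real.rpow_neg two_pos.le]; norm_num
    rwa [h4] at this
  obtain ⟨ρ, hρ1, hρ2⟩ := exists_between hquarter
  have hev := (hratio.eventually_const_lt hρ2).and (hGne.and (eventually_gt_atTop 0))
  obtain ⟨x₀, hx₀⟩ := eventually_atTop.1 hev
  refine ⟨ρ, hρ1, x₀, (hx₀ x₀ le_rfl).2.2, fun x hx => ?_⟩
  obtain ⟨h1, h2, -⟩ := hx₀ x hx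
  have hpos : 0 < G x := lt_of_le_of_ne measureReal_nonneg (Ne.symm h2)
  exact ⟨hpos, ((lt_div_iff₀ hpos).1 h1).le⟩

theorem integrable_min_sq (μ : Measure ℝ) [IsFiniteMeasure μ] (x : ℝ) :
    Integrable (fun y : ℝ => min (y ^ 2) (x ^ 2)) μ := by
  refine Integrable.of_bound (by fun_prop) (x ^ 2) (ae_of_all _ fun y => ?_)
  rw [Real.norm_of_nonneg (le_min (sq_nonneg _) (sq_nonneg _))]
  exact min_le_right _ _

/-- Raising the truncation level changes the integrand only where `x ≤ |y|`, and there it is at most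
`4 * x ^ 2`. Iterated along `2 ^ m * x₀`, this replaces Karamata's theorem. -/
theorem integral_min_sq_two_mul_le (μ : Measure ℝ) [IsFiniteMeasure μ] (x : ℝ) :
    ∫ y, min (y ^ 2) ((2 * x) ^ 2) ∂μ ≤
      ∫ y, min (y ^ 2) (x ^ 2) ∂μ + 4 * x ^ 2 * μ.real {y : ℝ | x ≤ |y|} := by
  have hm : MeasurableSet {y : ℝ | x ≤ |y|} := measurableSet_le (by fun_prop) (by fun_prop)
  have hI : Integrable (Set.indicator {y : ℝ | x ≤ |y|} fun _ => 4 * x ^ 2) μ :=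
    (integrable_const _).indicator hm
  have h : ∫ y, Set.indicator {y : ℝ | x ≤ |y|} (fun _ => 4 * x ^ 2) y ∂μ =
      4 * x ^ 2 * μ.real {y : ℝ | x ≤ |y|} := by
    rw [integral_indicator_const _ hm, smul_eq_mul, mul_comm]
  rw [← h, ← integral_add (integrable_min_sq μ x) hI]
  refine integral_mono (integrable_min_sq μ _) ((integrable_min_sq μ x).add hI) fun y => ?_
  by_cases hy : x ≤ |y|
  · have h0 : 0 ≤ min (y ^ 2) (x ^ 2) := le_min (sq_nonneg _) (sq_nonneg _)
    have h1 : min (y ^ 2) ((2 * x) ^ 2) ≤ (2 * x) ^ 2 := min_le_right _ _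
    simp only [Set.indicator_of_mem (show y ∈ {y : ℝ | x ≤ |y|} from hy)]
    linarith
  · have hxy : y ^ 2 ≤ x ^ 2 := by
      rw [← sq_abs y]
      exact pow_le_pow_left₀ (abs_nonneg y) (not_le.1 hy).le 2
    simp only [Set.indicator_of_notMem (show y ∉ {y : ℝ | x ≤ |y|} from hy)]
    rw [min_eq_left hxy, add_zero]
    exact min_le_left _ _

theorem tendsto_measureReal_le_abs (μ : Measure ℝ) [IsFiniteMeasure μ] :
    Tendsto (fun x : ℝ => μ.real {y : ℝ | x ≤ |y|}) atTop (𝓝 0) := by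
  have h := tendsto_measure_iInter_atTop (μ := μ) (s := fun x : ℝ => {y : ℝ | x ≤ |y|})
    (fun x => (measurableSet_le (by fun_prop) (by fun_prop)).nullMeasurableSet)
    (fun x x' hx y hy => le_trans hx hy) ⟨0, measure_ne_top _ _⟩
  have he : ⋂ x : ℝ, {y : ℝ | x ≤ |y|} = ∅ := by
    ext y
    simp only [Set.mem_iInter, Set.mem_ofPred_eq, Set.mem_empty_iff_false, iff_false, not_forall]
    exact ⟨|y| + 1, by linarith⟩
  rw [he, measure_empty] at h
  simpa [Measure.real, Function.comp_def] using (ENNReal.tendsto_toReal ENNReal.zero_ne_top).comp h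

/-- For a regularly varying tail of index less than two, there are truncation levels at which the
tail is of order `1 / p` while the truncated second moment is a small multiple of `x ^ 2 / p`. -/
theorem RegularlyVaryingTail.exists_level {μ : Measure ℝ} [IsProbabilityMeasure μ] {α : ℝ}
    (hα2 : α < 2) (hμ : RegularlyVaryingTail μ α) {η : ℝ} (hη : 0 < η) :
    ∃ b : ℝ, 0 < b ∧ ∀ᶠ p : ℕ in atTop, ∃ x : ℝ, 0 < x ∧ b / p ≤ μ.real {y : ℝ | x ≤ |y|} ∧
      p * ∫ y, min (y ^ 2) (x ^ 2) ∂μ ≤ η * x ^ 2 := by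
  obtain ⟨ρ, hρ, x₀, hx₀, hd⟩ := hμ.exists_doubling hα2
  set G : ℝ → ℝ := fun x => μ.real {y : ℝ | x ≤ |y|} with hG
  set h : ℝ → ℝ := fun x => ∫ y, min (y ^ 2) (x ^ 2) ∂μ with hh
  have hρ0 : 0 < ρ := by linarith
  set X : ℕ → ℝ := fun m => 2 ^ m * x₀ with hX
  have hXge : ∀ m, x₀ ≤ X m := fun m =>
    le_mul_of_one_le_left hx₀.le (one_le_pow₀ one_le_two)
  have hXpos : ∀ m, 0 < X m := fun m => hx₀.trans_le (hXge m)
  have hXs : ∀ m, X (m + 1) = 2 * X m := fun m => by simp only [hX]; ring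
  -- `C` closes the induction `hbound`: `h (2x) ≤ (C + 4) x² G x ≤ 4ρC x² G x ≤ C (2x)² G (2x)`.
  -- Such a `C` exists because `4ρ > 1`.
  obtain ⟨C, hC0, hC1, hC2⟩ : ∃ C : ℝ, 0 < C ∧ h (X 0) ≤ C * (X 0 ^ 2 * G (X 0)) ∧
      C + 4 ≤ 4 * ρ * C := by
    have hpos : 0 < X 0 ^ 2 * G (X 0) := mul_pos (pow_pos (hXpos 0) 2) (hd _ (hXge 0)).1
    have hr : 0 < 4 * ρ - 1 := by linarith
    refine ⟨max (h (X 0) / (X 0 ^ 2 * G (X 0))) (4 / (4 * ρ - 1)),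
      lt_max_of_lt_right (by positivity), ?_, ?_⟩
    · exact (div_le_iff₀ hpos).1 (le_max_left _ _)
    · have := (div_le_iff₀ hr).1 (le_max_right (h (X 0) / (X 0 ^ 2 * G (X 0))) (4 / (4 * ρ - 1)))
      linarith
  have hbound : ∀ m, h (X m) ≤ C * (X m ^ 2 * G (X m)) := by
    intro m
    induction m with
    | zero => exact hC1
    | succ m ih =>
      have h1 : h (2 * X m) ≤ h (X m) + 4 * X m ^ 2 * G (X m) :=
        integral_min_sq_two_mul_le μ (X m)
      obtain ⟨hp, h2⟩ := hd _ (hXge m)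
      have hV : 0 < X m ^ 2 * G (X m) := mul_pos (pow_pos (hXpos m) 2) hp
      have h3 : C * (4 * X m ^ 2) * (ρ * G (X m)) ≤ C * (4 * X m ^ 2) * G (2 * X m) :=
        mul_le_mul_of_nonneg_left h2 (by positivity)
      have h4 := mul_le_mul_of_nonneg_right hC2 hV.le
      rw [hXs]
      nlinarith
  set c : ℝ := η / C with hc
  have hc0 : 0 < c := div_pos hη hC0
  have hlim : Tendsto (fun m => G (X m)) atTop (𝓝 0) :=
    (tendsto_measureReal_le_abs μ).comp
      ((tendsto_pow_atTop_atTop_of_one_lt one_lt_two).atTop_mul_const hx₀)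
  have hcp : Tendsto (fun p : ℕ => c / p) atTop (𝓝 0) := tendsto_const_div_atTop_nhds_zero_nat c
  refine ⟨ρ * c, mul_pos hρ0 hc0, ?_⟩
  filter_upwards [hcp.eventually_lt_const (hd _ (hXge 0)).1, eventually_gt_atTop 0] with p hp hp0
  have hp0' : (0 : ℝ) < p := Nat.cast_pos.2 hp0
  -- Take the first dyadic level with tail at most `c / p`. For large `p` it is not level `0`, so
  -- the preceding tail exceeds `c / p` and doubling loses only the factor `ρ`.
  have hex : ∃ m, G (X m) ≤ c / p :=
    ((hlim.eventually_lt_const (div_pos hc0 hp0')).mono fun _ h => h.le).exists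
  classical
  have hfind := Nat.find_spec hex
  have hmin : ∀ k < Nat.find hex, ¬ G (X k) ≤ c / p := fun k hk => Nat.find_min hex hk
  generalize Nat.find hex = m at hfind hmin
  refine ⟨X m, hXpos m, ?_, ?_⟩
  · cases m with
    | zero => exact absurd hfind (not_le.2 hp)
    | succ k =>
      have h1 := not_le.1 (hmin k (Nat.lt_succ_self k))
      have h2 := (hd _ (hXge k)).2
      rw [hXs]
      calc ρ * c / p = ρ * (c / p) := by ring
        _ ≤ ρ * G (X k) := mul_le_mul_of_nonneg_left h1.le hρ0.le
        _ ≤ _ := h2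
  · have h1 := hbound m
    have h2 : (p : ℝ) * G (X m) ≤ c := by
      rw [mul_comm]; exact (le_div_iff₀ hp0').1 hfind
    calc p * h (X m) ≤ p * (C * (X m ^ 2 * G (X m))) := by gcongr
      _ = (p * G (X m)) * (C * X m ^ 2) := by ring
      _ ≤ c * (C * X m ^ 2) := by gcongr
      _ = η * X m ^ 2 := by rw [hc]; field_simp

/-! ### The birthday bound -/

/-- A birthday bound: if `2 m` independent points of common law `ν` are thrown and each of the
disjoint cells `S k` has `ν`-mass at least `q`, then it is unlikely that no cell is hit twice. -/
theorem measureReal_no_collision_le {Ω E κ : Type*} [MeasurableSpace Ω] [MeasurableSpace E]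
    [Fintype κ] {P : Measure Ω} [IsProbabilityMeasure P] {ν : Measure E} [IsProbabilityMeasure ν]
    {m : ℕ} {X : Fin m ⊕ Fin m → Ω → E} (hX : ∀ i, HasLaw (X i) ν P) (hind : iIndepFun X P)
    {S : κ → Set E} (hS : ∀ k, MeasurableSet (S k)) (hdisj : Pairwise (Function.onFun Disjoint S))
    {q : ℝ} (hq0 : 0 ≤ q) (hq : ∀ k, q ≤ ν.real (S k)) :
    P.real {ω | ∀ i j, i ≠ j → ∀ k, X i ω ∈ S k → X j ω ∉ S k} ≤
      Real.exp (-(m * (Fintype.card κ * q) * (1 - Real.exp (-(m * q))))) := by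
  classical
  -- An assignment `a` records the cell of each of the first `m` points, `none` meaning no cell;
  -- hence `none` is the empty set in `S₀` (the region to avoid) and the complement of all cells in
  -- `S₁` (the actual location). Without a collision, `a` is injective on occupied cells and the
  -- last `m` points all lie in `A a`.
  set S₀ : Option κ → Set E := fun o => o.elim ∅ S with hS₀
  set S₁ : Option κ → Set E := fun o => o.elim (⋃ k, S k)ᶜ S with hS₁
  set w : Option κ → ℝ := fun o => o.elim 0 fun _ => q with hw
  have hS₀m : ∀ o, MeasurableSet (S₀ o) := by
    rintro (_ | k)
    exacts [MeasurableSet.empty, hS k]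
  have hUm : MeasurableSet (⋃ k, S k) := MeasurableSet.iUnion hS
  have hS₁m : ∀ o, MeasurableSet (S₁ o) := by
    rintro (_ | k)
    exacts [hUm.compl, hS k]
  set A : (Fin m → Option κ) → Set E := fun a => (⋃ i, S₀ (a i))ᶜ with hA
  have hAm : ∀ a, MeasurableSet (A a) := fun a => (MeasurableSet.iUnion fun i => hS₀m _).compl
  set R : Finset (Fin m → Option κ) :=
    Finset.univ.filter fun a => ∀ i j k, a i = some k → a j = some k → i = j with hR
  set B : (Fin m → Option κ) → Fin m ⊕ Fin m → Set E :=
    fun a t => t.elim (fun i => S₁ (a i)) fun _ => A a with hB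
  have hBm : ∀ a t, MeasurableSet (B a t) := by
    rintro a (i | j)
    exacts [hS₁m _, hAm _]
  have hcover : {ω | ∀ i j, i ≠ j → ∀ k, X i ω ∈ S k → X j ω ∉ S k} ⊆
      ⋃ a ∈ R, ⋂ t ∈ Finset.univ, X t ⁻¹' B a t := by
    intro ω hω
    have hex : ∀ i : Fin m, ∃ o : Option κ, X (Sum.inl i) ω ∈ S₁ o := by
      intro i
      by_cases h : ∃ k, X (Sum.inl i) ω ∈ S k
      · obtain ⟨k, hk⟩ := h
        exact ⟨some k, hk⟩
      · exact ⟨none, by simpa [hS₁] using h⟩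
    choose a ha using hex
    have hak : ∀ i k, a i = some k → X (Sum.inl i) ω ∈ S k := fun i k h => by
      have := ha i
      rw [h] at this
      exact this
    simp only [Set.mem_iUnion, Set.mem_iInter]
    refine ⟨a, ?_, ?_⟩
    · simp only [hR, Finset.mem_filter, Finset.mem_univ, true_and]
      intro i j k hi hj
      by_contra hij
      exact hω (Sum.inl i) (Sum.inl j) (by simpa using hij) k (hak i k hi) (hak j k hj)
    · rintro (i | j) -
      · exact ha i
      · change X (Sum.inr j) ω ∈ (⋃ i, S₀ (a i))ᶜ
        simp only [Set.mem_compl_iff, Set.mem_iUnion, not_exists]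
        intro i hi
        cases h : a i with
        | none => rw [h] at hi; exact hi
        | some k =>
          rw [h] at hi
          exact hω (Sum.inl i) (Sum.inr j) (by simp) k (hak i k h) hi
  have hprod : ∀ a, P.real (⋂ t ∈ Finset.univ, X t ⁻¹' B a t) =
      (∏ i, ν.real (S₁ (a i))) * ν.real (A a) ^ m := by
    intro a
    rw [Measure.real, hind.measure_inter_preimage_eq_mul Finset.univ fun t _ => hBm a t,
      ENNReal.toReal_prod, Fintype.prod_sum_type]
    have hlaw : ∀ t, (P (X t ⁻¹' B a t)).toReal = ν.real (B a t) := fun t =>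
      (hX t).measureReal_eq (hBm a t)
    simp only [hlaw]
    simp [hB]
  have hAle : ∀ a ∈ R, ν.real (A a) ≤ Real.exp (-∑ i, w (a i)) := by
    intro a ha
    simp only [hR, Finset.mem_filter, Finset.mem_univ, true_and] at ha
    have hd : Pairwise (Function.onFun Disjoint fun i => S₀ (a i)) := by
      intro i j hij
      change Disjoint (S₀ (a i)) (S₀ (a j))
      cases hi : a i with
      | none => exact Set.empty_disjoint _
      | some k =>
        cases hj : a j with
        | none => exact Set.disjoint_empty _
        | some l =>
          refine hdisj fun hkl => hij (ha i j k hi (by rw [hj, hkl]))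
    have h1 : ∑ i, w (a i) ≤ ν.real (⋃ i, S₀ (a i)) := by
      rw [measureReal_iUnion_fintype hd fun i => hS₀m _]
      refine Finset.sum_le_sum fun i _ => ?_
      cases a i with
      | none => simp [hw, hS₀]
      | some k => exact hq k
    have h2 : ν.real (A a) = 1 - ν.real (⋃ i, S₀ (a i)) :=
      probReal_compl_eq_one_sub (MeasurableSet.iUnion fun i => hS₀m _)
    have h3 := Real.add_one_le_exp (-∑ i, w (a i))
    linarith
  set s : ℝ := ∑ k, ν.real (S k) with hs
  have hUs : ν.real (⋃ k, S k) = s := measureReal_iUnion_fintype hdisj hS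
  have hscard : Fintype.card κ * q ≤ s := by
    have := Finset.card_nsmul_le_sum Finset.univ (fun k => ν.real (S k)) q fun k _ => hq k
    simpa [Finset.card_univ] using this
  -- The total weight of one point of the first half; each occupied cell contributes the factor `exp
  -- (-(m * q))` for being avoided by the second half.
  have hone : ∑ o, ν.real (S₁ o) * Real.exp (-(m * w o)) =
      1 - s * (1 - Real.exp (-(m * q))) := by
    rw [Fintype.sum_option]
    simp only [hS₁, hw, Option.elim]
    rw [probReal_compl_eq_one_sub hUm, hUs, ← Finset.sum_mul, ← hs]
    simp
    ring
  have hexp1 : 0 ≤ 1 - Real.exp (-(m * q)) := by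
    rw [sub_nonneg, Real.exp_le_one_iff, neg_nonpos]
    positivity
  calc P.real {ω | ∀ i j, i ≠ j → ∀ k, X i ω ∈ S k → X j ω ∉ S k}
      ≤ P.real (⋃ a ∈ R, ⋂ t ∈ Finset.univ, X t ⁻¹' B a t) :=
        measureReal_mono hcover (measure_ne_top _ _)
    _ ≤ ∑ a ∈ R, P.real (⋂ t ∈ Finset.univ, X t ⁻¹' B a t) :=
        measureReal_biUnion_finset_le _ _
    _ = ∑ a ∈ R, (∏ i, ν.real (S₁ (a i))) * ν.real (A a) ^ m :=
        Finset.sum_congr rfl fun a _ => hprod a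
    _ ≤ ∑ a ∈ R, ∏ i, ν.real (S₁ (a i)) * Real.exp (-(m * w (a i))) := by
        refine Finset.sum_le_sum fun a ha => ?_
        rw [Finset.prod_mul_distrib, ← Real.exp_sum, Finset.sum_neg_distrib, ← Finset.mul_sum,
          ← mul_neg, Real.exp_nat_mul]
        refine mul_le_mul_of_nonneg_left ?_ (Finset.prod_nonneg fun _ _ => measureReal_nonneg)
        exact pow_le_pow_left₀ measureReal_nonneg (hAle a ha) m
    -- Injectivity was needed only to add up the masses of the occupied cells in `hAle`. Dropping it
    -- now lets the sum of products factor as an `m`-th power.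
    _ ≤ ∑ a : Fin m → Option κ, ∏ i, ν.real (S₁ (a i)) * Real.exp (-(m * w (a i))) :=
        Finset.sum_le_sum_of_subset_of_nonneg (Finset.subset_univ _) fun a _ _ =>
          Finset.prod_nonneg fun _ _ => mul_nonneg measureReal_nonneg (Real.exp_pos _).le
    _ = (1 - s * (1 - Real.exp (-(m * q)))) ^ m := by
        rw [← hone, Fintype.sum_pow]
    _ ≤ Real.exp (-(s * (1 - Real.exp (-(m * q))))) ^ m := by
        refine pow_le_pow_left₀ ?_ ?_ m
        · rw [← hone]
          exact Finset.sum_nonneg fun _ _ => mul_nonneg measureReal_nonneg (Real.exp_pos _).le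
        · have := Real.add_one_le_exp (-(s * (1 - Real.exp (-(m * q)))))
          linarith
    _ = Real.exp (-(m * s * (1 - Real.exp (-(m * q))))) := by
        rw [← Real.exp_nat_mul]
        congr 1
        ring
    _ ≤ Real.exp (-(m * (Fintype.card κ * q) * (1 - Real.exp (-(m * q))))) := by
        gcongr

/-- With `p = o(n ^ 2)` cells of mass at least `b / p`, the birthday bound tends to zero. -/
theorem tendsto_birthday_bound {b : ℝ} (hb : 0 < b) {p : ℕ → ℕ} (hp : Tendsto p atTop atTop)
    (hpn : (fun n => (p n : ℝ)) =o[atTop] (fun n : ℕ => (n : ℝ) ^ 2)) :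
    Tendsto (fun n => Real.exp (-((n / 2 : ℕ) * (p n * (b / p n)) *
      (1 - Real.exp (-((n / 2 : ℕ) * (b / p n))))))) atTop (𝓝 0) := by
  refine Real.tendsto_exp_neg_atTop_nhds_zero.comp ?_
  have hm : Tendsto (fun n : ℕ => ((n / 2 : ℕ) : ℝ)) atTop atTop :=
    tendsto_natCast_atTop_atTop.comp (Nat.tendsto_div_const_atTop two_ne_zero)
  have hmn : (fun n : ℕ => (n : ℝ) ^ 2) =O[atTop] fun n : ℕ => ((n / 2 : ℕ) : ℝ) ^ 2 := by
    refine IsBigO.of_bound 9 ?_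
    filter_upwards [eventually_ge_atTop 2] with n hn
    rw [Real.norm_of_nonneg (by positivity), Real.norm_of_nonneg (by positivity)]
    have h : (n : ℝ) ≤ 3 * (n / 2 : ℕ) := by
      have : n ≤ 3 * (n / 2) := by omega
      exact_mod_cast this
    calc (n : ℝ) ^ 2 ≤ (3 * (n / 2 : ℕ)) ^ 2 := by gcongr
      _ = _ := by ring
  have h1 := (hpn.trans_isBigO hmn).tendsto_div_nhds_zero.div_const b
  have h2 := h1.add (tendsto_inv_atTop_zero.comp hm)
  simp only [zero_div, add_zero] at h2
  have h3 : Tendsto (fun n : ℕ => b * ((p n : ℝ) / ((n / 2 : ℕ) : ℝ) ^ 2 / b +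
      (((n / 2 : ℕ) : ℝ))⁻¹)⁻¹) atTop atTop := by
    refine Tendsto.const_mul_atTop hb (Tendsto.inv_tendsto_nhdsGT_zero ?_)
    rw [tendsto_nhdsWithin_iff]
    refine ⟨h2, ?_⟩
    filter_upwards [hm.eventually_gt_atTop 0] with n hn
    simp only [Set.mem_Ioi]
    positivity
  refine tendsto_atTop_mono' _ ?_ h3
  filter_upwards [hm.eventually_gt_atTop 0, hp.eventually_gt_atTop 0] with n hn hpn0
  have hP : (0 : ℝ) < p n := Nat.cast_pos.2 hpn0
  set M : ℝ := ((n / 2 : ℕ) : ℝ)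
  set y : ℝ := M * (b / p n) with hy
  have hy0 : 0 < y := by positivity
  -- This bound serves small and large `y` alike, so `p` may be of smaller or larger order than `n`.
  have he : y / (1 + y) ≤ 1 - Real.exp (-y) := by
    have h5 := Real.add_one_le_exp y
    have h6 : Real.exp (-y) ≤ (1 + y)⁻¹ := by
      rw [Real.exp_neg]
      exact inv_anti₀ (by positivity) (by linarith)
    have h7 : y / (1 + y) = 1 - (1 + y)⁻¹ := by field_simp; ring
    linarith
  calc b * ((p n : ℝ) / M ^ 2 / b + M⁻¹)⁻¹ = M * (p n * (b / p n)) * (y / (1 + y)) := by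
        rw [hy]; field_simp
    _ ≤ _ := by gcongr

/-! ### Spherical mass near the vertices of the cross-polytope -/

theorem measurable_sphereProj {p : ℕ} : Measurable (sphereProj (p := p)) := by
  unfold sphereProj
  fun_prop

/-- Only an inequality holds in general: division by zero sends the zero vector to `0`. -/
theorem norm_sphereProj_le_one {p : ℕ} (z : Fin p → ℝ) : ‖sphereProj z‖ ≤ 1 := by
  have h0 : 0 ≤ ∑ l, z l ^ 2 := Finset.sum_nonneg fun _ _ => sq_nonneg _
  rw [← sq_le_one_iff₀ (norm_nonneg _), EuclideanSpace.norm_sq_eq]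
  simp only [sphereProj, Real.norm_eq_abs, sq_abs, div_pow, Real.sq_sqrt h0]
  rw [← Finset.sum_div]
  exact div_self_le_one _

theorem inner_sphereProj {p : ℕ} (z w : Fin p → ℝ) :
    inner ℝ (sphereProj z) (sphereProj w) =
      (∑ k, z k * w k) / (√(∑ k, z k ^ 2) * √(∑ k, w k ^ 2)) := by
  simp only [sphereProj, PiLp.inner_apply, Finset.sum_div]
  refine Finset.sum_congr rfl fun k _ => ?_
  simp only [RCLike.inner_apply, conj_trivial]
  rw [div_mul_div_comm, mul_comm (w k), mul_comm (√(∑ k, w k ^ 2))]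

theorem norm_single_of_sign {p : ℕ} {s : ℝ} (hs : s = 1 ∨ s = -1) (k : Fin p) :
    ‖EuclideanSpace.single k s‖ = 1 := by
  rcases hs with rfl | rfl <;> simp

/-- A vector one of whose coordinates dominates projects close to a vertex of the
cross-polytope. -/
theorem dist_sphereProj_single_lt {p : ℕ} {z : Fin p → ℝ} {k : Fin p} {s x κ δ : ℝ}
    (hs : s = 1 ∨ s = -1) (hx : 0 < x) (hκ0 : 0 ≤ κ) (hδ : 0 < δ) (hκδ : 2 * κ ≤ δ ^ 2)
    (hk : x ≤ s * z k) (hrest : ∑ j ∈ Finset.univ.erase k, z j ^ 2 < κ * x ^ 2) :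
    dist (sphereProj z) (EuclideanSpace.single k s) < δ := by
  have hs2 : s ^ 2 = 1 := by rcases hs with rfl | rfl <;> norm_num
  set t := s * z k with ht
  have ht0 : 0 < t := hx.trans_le hk
  set r := √(∑ l, z l ^ 2) with hr
  have hzk : z k ^ 2 = t ^ 2 := by rw [ht, mul_pow, hs2, one_mul]
  have hsum : ∑ l, z l ^ 2 = t ^ 2 + ∑ j ∈ Finset.univ.erase k, z j ^ 2 := by
    rw [← hzk, Finset.add_sum_erase _ (fun l => z l ^ 2) (Finset.mem_univ k)]
  have hrest0 : 0 ≤ ∑ j ∈ Finset.univ.erase k, z j ^ 2 :=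
    Finset.sum_nonneg fun _ _ => sq_nonneg _
  have hr2 : r ^ 2 = t ^ 2 + ∑ j ∈ Finset.univ.erase k, z j ^ 2 := by
    rw [hr, Real.sq_sqrt (by rw [hsum]; positivity), hsum]
  have hxt : κ * x ^ 2 ≤ κ * t ^ 2 := by gcongr
  have hr0 : 0 < r := Real.sqrt_pos.2 (by rw [hsum]; positivity)
  have hrt : r < (1 + κ) * t := by
    refine lt_of_pow_lt_pow_left₀ 2 (by positivity) ?_
    have : 0 ≤ κ * t ^ 2 + κ ^ 2 * t ^ 2 := by positivity
    nlinarith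
  -- The cosine of the angle to the vertex; the squared distance is then at most `2 - 2 * (t / r) <
  -- 2 * κ ≤ δ ^ 2`.
  have hratio : 1 - κ < t / r := by
    rw [lt_div_iff₀ hr0]
    rcases le_or_gt (1 - κ) 0 with h | h
    · nlinarith
    · nlinarith [mul_pos h (sub_pos.2 hrt), mul_nonneg (sq_nonneg κ) ht0.le]
  have hinner : inner ℝ (sphereProj z) (EuclideanSpace.single k s) = t / r := by
    rw [EuclideanSpace.inner_single_right, ht, hr]
    simp only [sphereProj, conj_trivial]
    ring
  have hnorm := norm_sphereProj_le_one z
  refine lt_of_pow_lt_pow_left₀ 2 hδ.le ?_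
  rw [dist_eq_norm, norm_sub_sq_real, hinner, norm_single_of_sign hs]
  have h2 : ‖sphereProj z‖ ^ 2 ≤ 1 := pow_le_one₀ (norm_nonneg _) hnorm
  linarith

/-- The probability that a given coordinate of an i.i.d. vector exceeds the level `x` with sign
`s` while the remaining coordinates are negligible. -/
theorem half_mul_le_measureReal_dominant {μ : Measure ℝ} [IsProbabilityMeasure μ] {p : ℕ}
    (k : Fin p) {s x κ : ℝ} (hx : 0 < x) (hκ0 : 0 < κ) (hκ1 : κ ≤ 1)
    (hmom : p * ∫ y, min (y ^ 2) (x ^ 2) ∂μ ≤ κ / 2 * x ^ 2) :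
    1 / 2 * μ.real {y : ℝ | x ≤ s * y} ≤
      (Measure.pi fun _ : Fin p => μ).real {z | x ≤ s * z k ∧
        ∑ j ∈ Finset.univ.erase k, z j ^ 2 < κ * x ^ 2} := by
  set Q := Measure.pi fun _ : Fin p => μ with hQ
  -- Coordinate `k` is kept and the others are replaced by truncated squares, so the sum `T` of the
  -- latter is integrable and independent of the former.
  set f : Fin p → (Fin p → ℝ) → ℝ := fun j z =>
    Function.update (fun _ y => min (y ^ 2) (x ^ 2)) k (id : ℝ → ℝ) j (z j) with hf
  have hmeas : ∀ j, Measurable (Function.update (fun _ y => min (y ^ 2) (x ^ 2)) k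
      (id : ℝ → ℝ) j) := by
    intro j
    rcases eq_or_ne j k with rfl | hj
    · simpa using measurable_id
    · rw [Function.update_of_ne hj]
      fun_prop
  have hfk : f k = fun z => z k := by simp [hf]
  have hfj : ∀ j, j ≠ k → f j = fun z => min (z j ^ 2) (x ^ 2) := fun j hj => by
    simp [hf, Function.update_of_ne hj]
  have hind : iIndepFun f Q := iIndepFun_pi fun j => (hmeas j).aemeasurable
  have hpair := hind.indepFun_finsetSum_of_notMem
    (fun j => (hmeas j).comp (measurable_pi_apply j)) (Finset.notMem_erase k Finset.univ)
  set T : (Fin p → ℝ) → ℝ := ∑ j ∈ Finset.univ.erase k, f j with hT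
  have hTapp : ∀ z, T z = ∑ j ∈ Finset.univ.erase k, min (z j ^ 2) (x ^ 2) := fun z => by
    rw [hT, Finset.sum_apply]
    exact Finset.sum_congr rfl fun j hj => by rw [hfj j (Finset.ne_of_mem_erase hj)]
  have hTm : Measurable T := by
    have : T = fun z => ∑ j ∈ Finset.univ.erase k, min (z j ^ 2) (x ^ 2) := funext hTapp
    rw [this]
    fun_prop
  have hlaw : ∀ j, HasLaw (fun z : Fin p → ℝ => z j) μ Q := fun j =>
    (measurePreserving_eval (fun _ : Fin p => μ) j).hasLaw
  have hint : ∀ j, Integrable (fun z : Fin p → ℝ => min (z j ^ 2) (x ^ 2)) Q := fun j =>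
    (measurePreserving_eval (fun _ : Fin p => μ) j).integrable_comp_of_integrable
      (integrable_min_sq μ x)
  have hTint : Integrable T Q := by
    have : T = fun z => ∑ j ∈ Finset.univ.erase k, min (z j ^ 2) (x ^ 2) := funext hTapp
    rw [this]
    exact integrable_finsetSum _ fun j _ => hint j
  have hI0 : 0 ≤ ∫ y, min (y ^ 2) (x ^ 2) ∂μ :=
    integral_nonneg fun y => le_min (sq_nonneg _) (sq_nonneg _)
  have hET : ∫ z, T z ∂Q ≤ κ / 2 * x ^ 2 := by
    refine le_trans ?_ hmom
    simp only [hTapp]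
    rw [integral_finsetSum _ fun j _ => hint j]
    have : ∀ j, ∫ z : Fin p → ℝ, min (z j ^ 2) (x ^ 2) ∂Q = ∫ y, min (y ^ 2) (x ^ 2) ∂μ :=
      fun j => (hlaw j).integral_comp (f := fun y => min (y ^ 2) (x ^ 2)) (by fun_prop)
    simp only [this, Finset.sum_const, nsmul_eq_mul]
    gcongr
    simp
  have hx2 : 0 < κ * x ^ 2 := by positivity
  have hmarkov : Q.real {z | κ * x ^ 2 ≤ T z} ≤ 1 / 2 := by
    have h1 := mul_meas_ge_le_integral_of_nonneg
      (ae_of_all Q fun z => by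
        rw [hTapp]
        exact Finset.sum_nonneg fun j _ => le_min (sq_nonneg _) (sq_nonneg _))
      hTint (κ * x ^ 2)
    have h2 := h1.trans hET
    have h3 : κ * x ^ 2 * Q.real {z | κ * x ^ 2 ≤ T z} ≤ κ * x ^ 2 * (1 / 2) := by
      calc _ ≤ κ / 2 * x ^ 2 := h2
        _ = _ := by ring
    exact le_of_mul_le_mul_left h3 hx2
  have hTlt : 1 / 2 ≤ Q.real (T ⁻¹' Set.Iio (κ * x ^ 2)) := by
    have h1 : T ⁻¹' Set.Iio (κ * x ^ 2) = {z | κ * x ^ 2 ≤ T z}ᶜ := by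
      ext z; simp
    rw [h1, probReal_compl_eq_one_sub (measurableSet_le measurable_const hTm)]
    linarith
  have hsm : MeasurableSet {y : ℝ | x ≤ s * y} := measurableSet_le (by fun_prop) (by fun_prop)
  have hprod : Q.real (T ⁻¹' Set.Iio (κ * x ^ 2) ∩ f k ⁻¹' {y : ℝ | x ≤ s * y}) =
      Q.real (T ⁻¹' Set.Iio (κ * x ^ 2)) * μ.real {y : ℝ | x ≤ s * y} := by
    rw [Measure.real, hpair.measure_inter_preimage_eq_mul _ _ measurableSet_Iio hsm,
      ENNReal.toReal_mul]
    congr 1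
    rw [hfk]
    exact (hlaw k).measureReal_eq hsm
  calc 1 / 2 * μ.real {y : ℝ | x ≤ s * y}
      ≤ Q.real (T ⁻¹' Set.Iio (κ * x ^ 2)) * μ.real {y : ℝ | x ≤ s * y} := by gcongr
    _ = _ := hprod.symm
    _ ≤ _ := by
      refine measureReal_mono ?_ (measure_ne_top _ _)
      rintro z ⟨hz1, hz2⟩
      refine ⟨by simpa [hfk] using hz2, ?_⟩
      have hz1' : ∑ j ∈ Finset.univ.erase k, min (z j ^ 2) (x ^ 2) < κ * x ^ 2 := by
        rw [← hTapp]; exact hz1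
      -- Since `κ ≤ 1`, one truncated term would already push the sum up to `κ * x ^ 2`; so no
      -- truncation is active and `T` is the true sum of squares.
      have hle : ∀ j ∈ Finset.univ.erase k, z j ^ 2 ≤ x ^ 2 := by
        intro j hj
        by_contra hcon
        have h1 := Finset.single_le_sum (f := fun j => min (z j ^ 2) (x ^ 2))
          (fun j _ => le_min (sq_nonneg _) (sq_nonneg _)) hj
        simp only [min_eq_right (not_le.1 hcon).le] at h1
        nlinarith [sq_nonneg x]
      rwa [Finset.sum_congr rfl fun j hj => min_eq_left (hle j hj)] at hz1'

/-- Under regular variation of index less than two, each of the `p` vertices of one sign of the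
cross-polytope has a neighbourhood of spherical mass at least of order `1 / p`. -/
theorem RegularlyVaryingTail.exists_vertex_mass {μ : Measure ℝ} [IsProbabilityMeasure μ] {α : ℝ}
    (hα2 : α < 2) (hμ : RegularlyVaryingTail μ α) {δ : ℝ} (hδ : 0 < δ) :
    ∃ b : ℝ, 0 < b ∧ ∀ᶠ p : ℕ in atTop, ∃ s : ℝ, (s = 1 ∨ s = -1) ∧ ∀ k : Fin p,
      b / p ≤ (sphericalLaw μ p).real (Metric.ball (EuclideanSpace.single k s) δ) := by
  set κ : ℝ := min 1 (δ ^ 2 / 2) with hκ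
  have hκ0 : 0 < κ := lt_min one_pos (by positivity)
  obtain ⟨b, hb, hev⟩ := hμ.exists_level hα2 (half_pos hκ0)
  refine ⟨b / 4, by positivity, hev.mono ?_⟩
  rintro p ⟨x, hx, hbx, hmom⟩
  -- The heavier of the two tails at level `x` is used. The sign may vary with `p`, so no tail
  -- balance is needed.
  obtain ⟨s, hs, hsμ⟩ : ∃ s : ℝ, (s = 1 ∨ s = -1) ∧
      1 / 2 * μ.real {y : ℝ | x ≤ |y|} ≤ μ.real {y : ℝ | x ≤ s * y} := by
    have hU : {y : ℝ | x ≤ |y|} ⊆ {y : ℝ | x ≤ 1 * y} ∪ {y : ℝ | x ≤ -1 * y} := by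
      intro y hy
      simpa [le_abs] using hy
    have h1 : μ.real {y : ℝ | x ≤ |y|} ≤
        μ.real {y : ℝ | x ≤ 1 * y} + μ.real {y : ℝ | x ≤ -1 * y} :=
      (measureReal_mono hU (measure_ne_top _ _)).trans (measureReal_union_le _ _)
    rcases le_total (μ.real {y : ℝ | x ≤ 1 * y}) (μ.real {y : ℝ | x ≤ -1 * y}) with h | h
    · exact ⟨-1, Or.inr rfl, by linarith⟩
    · exact ⟨1, Or.inl rfl, by linarith⟩
  refine ⟨s, hs, fun k => ?_⟩
  have hdom := half_mul_le_measureReal_dominant (s := s) k hx hκ0 (min_le_left _ _) hmom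
  have hball : (Measure.pi fun _ : Fin p => μ).real {z | x ≤ s * z k ∧
      ∑ j ∈ Finset.univ.erase k, z j ^ 2 < κ * x ^ 2} ≤
      (sphericalLaw μ p).real (Metric.ball (EuclideanSpace.single k s) δ) := by
    rw [sphericalLaw, map_measureReal_apply measurable_sphereProj Metric.isOpen_ball.measurableSet]
    refine measureReal_mono ?_ (measure_ne_top _ _)
    rintro z ⟨hz1, hz2⟩
    refine dist_sphereProj_single_lt hs hx hκ0.le hδ ?_ hz1 hz2
    have := min_le_right 1 (δ ^ 2 / 2)
    linarith
  have : b / 4 / p = 1 / 4 * (b / p) := by ring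
  linarith

/-- Two such vertices differ by modulus `1` in coordinate `k`, so their distance is at least `1 ≥ 2
* δ`. -/
theorem disjoint_ball_single {p : ℕ} {s δ : ℝ} (hs : s = 1 ∨ s = -1) (hδ : δ ≤ 1 / 2) :
    Pairwise (Function.onFun Disjoint fun k : Fin p =>
      Metric.ball (EuclideanSpace.single k s) δ) := by
  intro k l hkl
  refine Metric.ball_disjoint_ball ?_
  have hs2 : |s| = 1 := by rcases hs with rfl | rfl <;> norm_num
  have h := PiLp.norm_apply_le (EuclideanSpace.single k s - EuclideanSpace.single l s) k
  rw [dist_eq_norm]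
  simp [hkl, hs2] at h
  linarith

/-- Expanding both vectors around `e` leaves an error below `2 * δ + δ ^ 2`, which is at most `3 *
δ`. -/
theorem one_sub_lt_inner_of_mem_ball {E : Type*} [NormedAddCommGroup E] [InnerProductSpace ℝ E]
    {u v e : E} {δ : ℝ} (he : ‖e‖ = 1) (hδ : δ ≤ 1 / 2) (hu : u ∈ Metric.ball e δ)
    (hv : v ∈ Metric.ball e δ) : 1 - 3 * δ < inner ℝ u v := by
  rw [mem_ball_iff_norm] at hu hv
  have hδ0 : 0 < δ := (norm_nonneg _).trans_lt hu
  have h1 : inner ℝ u v = 1 + inner ℝ e (v - e) + inner ℝ (u - e) e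
      + inner ℝ (u - e) (v - e) := by
    have h2 : inner ℝ e e = (1 : ℝ) := by rw [real_inner_self_eq_norm_sq, he, one_pow]
    simp only [inner_sub_left, inner_sub_right, h2]
    ring
  have h3 := neg_le_of_abs_le (abs_real_inner_le_norm e (v - e))
  have h4 := neg_le_of_abs_le (abs_real_inner_le_norm (u - e) e)
  have h5 := neg_le_of_abs_le (abs_real_inner_le_norm (u - e) (v - e))
  have h6 : ‖u - e‖ * ‖v - e‖ ≤ δ * δ := by gcongr
  rw [he] at h3 h4
  nlinarith

instance isProbabilityMeasure_sphericalLaw (μ : Measure ℝ) [IsProbabilityMeasure μ] (p : ℕ) :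
    IsProbabilityMeasure (sphericalLaw μ p) :=
  Measure.isProbabilityMeasure_map measurable_sphereProj.aemeasurable

theorem ae_norm_le_one_sphericalLaw (μ : Measure ℝ) [IsProbabilityMeasure μ] (p : ℕ) :
    ∀ᵐ u ∂sphericalLaw μ p, ‖u‖ ≤ 1 :=
  (ae_map_iff measurable_sphereProj.aemeasurable
    (measurableSet_le measurable_norm measurable_const)).2 (ae_of_all _ norm_sphereProj_le_one)

/-! ### Nearly parallel pairs and the limit theorems -/

/-- In a sample from the spherical law there is, with probability tending to one, a pair of
nearly parallel vectors. -/
theorem tendsto_measure_inner_le {α : ℝ} (hα2 : α < 2) {μ : Measure ℝ} [IsProbabilityMeasure μ]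
    (hμ : RegularlyVaryingTail μ α) {p : ℕ → ℕ} (hp : Tendsto p atTop atTop)
    (hpn : (fun n => (p n : ℝ)) =o[atTop] (fun n : ℕ => (n : ℝ) ^ 2))
    {Ω : ℕ → Type*} [∀ n, MeasurableSpace (Ω n)]
    (P : ∀ n, Measure (Ω n)) [∀ n, IsProbabilityMeasure (P n)]
    {X : ∀ n, Fin n → Ω n → EuclideanSpace ℝ (Fin (p n))}
    (hX : ∀ n i, HasLaw (X n i) (sphericalLaw μ (p n)) (P n))
    (hind : ∀ n, iIndepFun (X n) (P n)) {ε : ℝ} (hε : 0 < ε) :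
    Tendsto (fun n => P n {ω | ∀ i j, i < j → inner ℝ (X n i ω) (X n j ω) ≤ 1 - ε})
      atTop (𝓝 0) := by
  set δ : ℝ := min (1 / 2) (ε / 3) with hδ
  have hδ0 : 0 < δ := lt_min one_half_pos (by positivity)
  have hδ2 : δ ≤ 1 / 2 := min_le_left _ _
  have hδ3 : 3 * δ ≤ ε := by
    have := min_le_right (1 / 2) (ε / 3)
    linarith
  obtain ⟨b, hb, hev⟩ := hμ.exists_vertex_mass hα2 hδ0
  have hlim := ENNReal.tendsto_ofReal (tendsto_birthday_bound hb hp hpn)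
  rw [ENNReal.ofReal_zero] at hlim
  refine tendsto_of_tendsto_of_tendsto_of_le_of_le' tendsto_const_nhds hlim
    (Eventually.of_forall fun _ => zero_le) ?_
  filter_upwards [hp.eventually hev] with n hn
  obtain ⟨s, hs, hmass⟩ := hn
  -- The birthday bound takes two halves of equal size; for odd `n` the last point is discarded.
  have hle : n / 2 + n / 2 ≤ n := by omega
  set e : Fin (n / 2) ⊕ Fin (n / 2) → Fin n := fun t => Fin.castLE hle (finSumFinEquiv t) with he
  have hinj : Function.Injective e :=
    (Fin.castLE_injective hle).comp finSumFinEquiv.injective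
  have hbound := measureReal_no_collision_le (X := fun t => X n (e t))
    (fun t => hX n (e t)) ((hind n).precomp hinj)
    (S := fun k : Fin (p n) => Metric.ball (EuclideanSpace.single k s) δ)
    (fun k => Metric.isOpen_ball.measurableSet) (disjoint_ball_single hs hδ2)
    (q := b / p n) (by positivity) hmass
  rw [Fintype.card_fin] at hbound
  rw [← ofReal_measureReal (measure_ne_top _ _)]
  refine ENNReal.ofReal_le_ofReal (le_trans (measureReal_mono ?_ (measure_ne_top _ _)) hbound)
  intro ω hω t t' htt k hk hk'
  rcases lt_or_gt_of_ne (hinj.ne htt) with h | h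
  · have := one_sub_lt_inner_of_mem_ball (norm_single_of_sign hs k) hδ2 hk hk'
    linarith [hω _ _ h]
  · have := one_sub_lt_inner_of_mem_ball (norm_single_of_sign hs k) hδ2 hk' hk
    linarith [hω _ _ h]

theorem le_maxPairs {n : ℕ} (a : Fin n → Fin n → ℝ) {i j : Fin n} (hij : i < j) :
    a i j ≤ maxPairs a :=
  le_ciSup (f := fun q : {q : Fin n × Fin n // q.1 < q.2} => a q.1.1 q.1.2)
    (Set.finite_range _).bddAbove ⟨(i, j), hij⟩

theorem tendstoInProbability_maxPairs_inner {α : ℝ} (hα2 : α < 2) {μ : Measure ℝ}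
    [IsProbabilityMeasure μ]
    (hμ : RegularlyVaryingTail μ α) {p : ℕ → ℕ} (hp : Tendsto p atTop atTop)
    (hpn : (fun n => (p n : ℝ)) =o[atTop] (fun n : ℕ => (n : ℝ) ^ 2))
    {Ω : ℕ → Type*} [∀ n, MeasurableSpace (Ω n)]
    (P : ∀ n, Measure (Ω n)) [∀ n, IsProbabilityMeasure (P n)]
    {X : ∀ n, Fin n → Ω n → EuclideanSpace ℝ (Fin (p n))}
    (hX : ∀ n i, HasLaw (X n i) (sphericalLaw μ (p n)) (P n))
    (hind : ∀ n, iIndepFun (X n) (P n)) :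
    TendstoInProbability P (fun n ω => maxPairs fun i j => inner ℝ (X n i ω) (X n j ω)) 1 := by
  intro ε hε
  refine tendsto_of_tendsto_of_tendsto_of_le_of_le tendsto_const_nhds
    (tendsto_measure_inner_le hα2 hμ hp hpn P hX hind hε) (fun _ => zero_le) fun n => ?_
  refine measure_mono_ae ?_
  have hnorm : ∀ᵐ ω ∂P n, ∀ i, ‖X n i ω‖ ≤ 1 := ae_all_iff.2 fun i =>
    ae_of_ae_map (hX n i).aemeasurable (by
      rw [(hX n i).map_eq]; exact ae_norm_le_one_sphericalLaw μ (p n))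
  filter_upwards [hnorm] with ω hω hdev i j hij
  have hmax : maxPairs (fun i j => inner ℝ (X n i ω) (X n j ω)) ≤ 1 := by
    -- `zero_le_one` covers `n < 2`, where there are no pairs and the supremum is `0` by convention.
    refine Real.iSup_le (fun q => ?_) zero_le_one
    exact (real_inner_le_norm _ _).trans (mul_le_one₀ (hω _) (norm_nonneg _) (hω _))
  have hdev' : ε ≤ |maxPairs (fun i j => inner ℝ (X n i ω) (X n j ω)) - 1| := hdev
  rw [abs_of_nonpos (by linarith)] at hdev'
  have := le_maxPairs (fun i j => inner ℝ (X n i ω) (X n j ω)) hij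
  linarith

/-- One pair with inner product above `1 / 2` makes the leading term at least `p / 4`. Eventually `4
* log n ≤ p / 8` and `c < p / 8`, while `log (log n) ≥ 0` for `n ≥ 3`. -/
theorem tendsto_measure_lt_packingStatistic {α : ℝ} (hα2 : α < 2) {μ : Measure ℝ}
    [IsProbabilityMeasure μ]
    (hμ : RegularlyVaryingTail μ α) {p : ℕ → ℕ} (hp : Tendsto p atTop atTop)
    (hpn : (fun n => (p n : ℝ)) =o[atTop] (fun n : ℕ => (n : ℝ) ^ 2))
    {Ω : ℕ → Type*} [∀ n, MeasurableSpace (Ω n)]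
    (P : ∀ n, Measure (Ω n)) [∀ n, IsProbabilityMeasure (P n)]
    {X : ∀ n, Fin n → Ω n → EuclideanSpace ℝ (Fin (p n))}
    (hX : ∀ n i, HasLaw (X n i) (sphericalLaw μ (p n)) (P n))
    (hind : ∀ n, iIndepFun (X n) (P n))
    (hlog : (fun n : ℕ => Real.log n) =o[atTop] (fun n => (p n : ℝ))) (c : ℝ) :
    Tendsto (fun n => P n {ω | c < packingStatistic fun i => X n i ω}) atTop (𝓝 1) := by
  have hbad := tendsto_measure_inner_le hα2 hμ hp hpn P hX hind one_half_pos
  have hone : Tendsto (fun n => 1 - P n {ω | ∀ i j, i < j →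
      inner ℝ (X n i ω) (X n j ω) ≤ 1 - 1 / 2}) atTop (𝓝 1) := by
    simpa using ENNReal.Tendsto.sub tendsto_const_nhds hbad (Or.inl ENNReal.one_ne_top)
  refine tendsto_of_tendsto_of_tendsto_of_le_of_le' hone tendsto_const_nhds ?_
    (Eventually.of_forall fun _ => prob_le_one)
  have hpc : ∀ᶠ n in atTop, 8 * c < p n :=
    (tendsto_natCast_atTop_atTop.comp hp).eventually_gt_atTop (8 * c)
  filter_upwards [hpc, hlog.bound (show (0 : ℝ) < 1 / 32 by norm_num), eventually_ge_atTop 3]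
    with n hn hlogn hn3
  have hexp : Real.exp 1 ≤ n := by
    have h3 : (3 : ℝ) ≤ n := by exact_mod_cast hn3
    exact (Real.exp_one_lt_d9.le.trans (by norm_num)).trans h3
  have hn0 : (0 : ℝ) < n := (Real.exp_pos 1).trans_le hexp
  have hlog1 : 1 ≤ Real.log n := (Real.le_log_iff_exp_le hn0).2 hexp
  have hloglog : 0 ≤ Real.log (Real.log n) := Real.log_nonneg hlog1
  rw [Real.norm_of_nonneg (by linarith), Real.norm_of_nonneg (Nat.cast_nonneg _)] at hlogn
  have hcover : Set.univ ⊆ {ω | c < packingStatistic fun i => X n i ω} ∪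
      {ω | ∀ i j, i < j → inner ℝ (X n i ω) (X n j ω) ≤ (1 : ℝ) - 1 / 2} := by
    intro ω _
    by_contra hcon
    simp only [Set.mem_union, not_or, Set.mem_ofPred_eq, not_forall, not_le] at hcon
    obtain ⟨hc, i, j, hij, hgt⟩ := hcon
    apply hc
    have h1 := le_maxPairs (fun i j => (inner ℝ (X n i ω) (X n j ω) : ℝ) ^ 2) hij
    have h2 : (1 / 4 : ℝ) ≤ maxPairs fun i j => (inner ℝ (X n i ω) (X n j ω) : ℝ) ^ 2 := by
      refine le_trans ?_ h1
      nlinarith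
    have h3 : (p n : ℝ) * (1 / 4) ≤
        p n * maxPairs fun i j => (inner ℝ (X n i ω) (X n j ω) : ℝ) ^ 2 := by gcongr
    unfold packingStatistic
    linarith
  rw [tsub_le_iff_right, ← measure_univ (μ := P n)]
  exact (measure_mono hcover).trans (measure_union_le _ _)

/-- If the entries of an array are i.i.d., its rows are i.i.d. vectors with i.i.d. coordinates. -/
theorem iIndepFun_rows {Ω ι κ : Type*} [MeasurableSpace Ω] [Fintype ι] [Fintype κ]
    {P : Measure Ω} [IsProbabilityMeasure P] {μ : Measure ℝ} [IsProbabilityMeasure μ]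
    {Z : ι → κ → Ω → ℝ} (hZ : ∀ i k, HasLaw (Z i k) μ P)
    (hind : iIndepFun (fun q : ι × κ => Z q.1 q.2) P) :
    (∀ i, HasLaw (fun ω k => Z i k ω) (Measure.pi fun _ : κ => μ) P) ∧
      iIndepFun (fun i ω k => Z i k ω) P := by
  have hrow : ∀ i, HasLaw (fun ω k => Z i k ω) (Measure.pi fun _ : κ => μ) P := by
    intro i
    refine ⟨aemeasurable_pi_lambda _ fun k => (hZ i k).aemeasurable, ?_⟩
    rw [(hind.precomp (Prod.mk_right_injective i)).map_fun_eq_pi_map fun k =>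
      (hZ i k).aemeasurable]
    simp only [(hZ i _).map_eq]
  refine ⟨hrow, ?_⟩
  rw [iIndepFun_iff_map_fun_eq_pi_map fun i => (hrow i).aemeasurable]
  simp only [(hrow _).map_eq]
  -- The comparison is with the canonical array on the iterated product space. Its flattened entries
  -- are independent of law `μ`, hence have the same joint law as the given array, and regrouping
  -- both into rows identifies the law of the rows as `ν`.
  set ν : Measure (ι → κ → ℝ) := Measure.pi fun _ => Measure.pi fun _ => μ with hν
  have hcoord : ∀ (i : ι) (k : κ), HasLaw (fun z : ι → κ → ℝ => z i k) μ ν := fun i k =>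
    ((measurePreserving_eval (fun _ : κ => μ) k).comp
      (measurePreserving_eval (fun _ : ι => Measure.pi fun _ : κ => μ) i)).hasLaw
  have hνrows : iIndepFun (fun (i : ι) (z : ι → κ → ℝ) => z i) ν :=
    iIndepFun_pi (X := fun _ => id) fun _ => aemeasurable_id
  have hνrow : ∀ i, iIndepFun (fun (k : κ) (z : ι → κ → ℝ) => z i k) ν := by
    intro i
    rw [iIndepFun_iff_map_fun_eq_pi_map fun k => (hcoord i k).aemeasurable]
    simp only [(hcoord i _).map_eq]
    exact (measurePreserving_eval (fun _ : ι => Measure.pi fun _ : κ => μ) i).map_eq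
  have hνind : iIndepFun (fun (q : ι × κ) (z : ι → κ → ℝ) => z q.1 q.2) ν :=
    iIndepFun_uncurry' (X := fun i k (z : ι → κ → ℝ) => z i k) (fun i k => by fun_prop)
      hνrows hνrow
  have hP := hind.map_fun_eq_pi_map fun q : ι × κ => (hZ q.1 q.2).aemeasurable
  have hN := hνind.map_fun_eq_pi_map fun q : ι × κ => (hcoord q.1 q.2).aemeasurable
  simp only [(hZ _ _).map_eq] at hP
  simp only [(hcoord _ _).map_eq] at hN
  have hcurry : Measurable fun (y : ι × κ → ℝ) (i : ι) (k : κ) => y (i, k) := by fun_prop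
  have h := congrArg (Measure.map fun (y : ι × κ → ℝ) (i : ι) (k : κ) => y (i, k))
    (hP.trans hN.symm)
  rw [AEMeasurable.map_map_of_aemeasurable hcurry.aemeasurable
      (aemeasurable_pi_lambda _ fun q => (hZ q.1 q.2).aemeasurable),
    AEMeasurable.map_map_of_aemeasurable hcurry.aemeasurable
      (aemeasurable_pi_lambda _ fun q => (hcoord q.1 q.2).aemeasurable)] at h
  exact h.trans Measure.map_id

theorem tendstoInProbability_maxPairs_sampleCorr {α : ℝ} (hα2 : α < 2) {μ : Measure ℝ}
    [IsProbabilityMeasure μ]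
    (hμ : RegularlyVaryingTail μ α) {p : ℕ → ℕ} (hp : Tendsto p atTop atTop)
    (hpn : (fun n => (p n : ℝ)) =o[atTop] (fun n : ℕ => (n : ℝ) ^ 2))
    {Ω : ℕ → Type*} [∀ n, MeasurableSpace (Ω n)]
    (P : ∀ n, Measure (Ω n)) [∀ n, IsProbabilityMeasure (P n)]
    {Z : ∀ n, Fin n → Fin (p n) → Ω n → ℝ} (hZ : ∀ n i k, HasLaw (Z n i k) μ (P n))
    (hind : ∀ n, iIndepFun (fun q : Fin n × Fin (p n) => Z n q.1 q.2) (P n)) :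
    TendstoInProbability P (fun n ω => maxPairs (sampleCorr fun i k => Z n i k ω)) 1 := by
  have hX : ∀ n i, HasLaw (fun ω => sphereProj fun k => Z n i k ω)
      (sphericalLaw μ (p n)) (P n) := fun n i =>
    HasLaw.comp (Y := sphereProj) ⟨measurable_sphereProj.aemeasurable, rfl⟩
      ((iIndepFun_rows (hZ n) (hind n)).1 i)
  have hXind : ∀ n, iIndepFun (fun (i : Fin n) ω => sphereProj fun k => Z n i k ω) (P n) :=
    fun n => (iIndepFun_rows (hZ n) (hind n)).2.comp (fun _ => sphereProj)
      fun _ => measurable_sphereProj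
  have h := tendstoInProbability_maxPairs_inner hα2 hμ hp hpn P hX hXind
  simp only [inner_sphereProj] at h
  exact h

end HeavyTailPacking

theorem theorem3 (α : ℝ) (hα0 : 0 < α) (hα2 : α < 2)
    (μ : Measure ℝ) [IsProbabilityMeasure μ]
    (hμ : HeavyTailPacking.RegularlyVaryingTail μ α) (hμ0 : μ {0} = 0)
    (p : ℕ → ℕ) (hp : Tendsto p atTop atTop)
    (hpn : (fun n => (p n : ℝ)) =o[atTop] (fun n : ℕ => (n : ℝ) ^ 2))
    {Ω : ℕ → Type*} [∀ n, MeasurableSpace (Ω n)]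
    (P : ∀ n, Measure (Ω n)) [∀ n, IsProbabilityMeasure (P n)] :
    -- the data are i.i.d. from the spherical distribution generated by `μ`
    (∀ X : ∀ n, Fin n → Ω n → EuclideanSpace ℝ (Fin (p n)),
      (∀ n i, HasLaw (X n i) (HeavyTailPacking.sphericalLaw μ (p n)) (P n)) →
      (∀ n, iIndepFun (X n) (P n)) →
      HeavyTailPacking.TendstoInProbability P
        (fun n ω => HeavyTailPacking.maxPairs fun i j => inner ℝ (X n i ω) (X n j ω)) 1 ∧
      -- consistency of the packing test
      ((fun n : ℕ => Real.log n) =o[atTop] (fun n => (p n : ℝ)) →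
        ∀ c : ℝ, Tendsto
          (fun n => P n {ω | c < HeavyTailPacking.packingStatistic fun i => X n i ω})
          atTop (𝓝 1))) ∧
    -- sample correlations of an array with i.i.d. entries of law `μ`
    (∀ Z : ∀ n, Fin n → Fin (p n) → Ω n → ℝ,
      (∀ n i k, HasLaw (Z n i k) μ (P n)) →
      (∀ n, iIndepFun (fun q : Fin n × Fin (p n) => Z n q.1 q.2) (P n)) →
      HeavyTailPacking.TendstoInProbability P
        (fun n ω => HeavyTailPacking.maxPairs
          (HeavyTailPacking.sampleCorr fun i k => Z n i k ω)) 1) := by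
  exact ⟨fun _ hX hind =>
    ⟨HeavyTailPacking.tendstoInProbability_maxPairs_inner hα2 hμ hp hpn P hX hind,
      HeavyTailPacking.tendsto_measure_lt_packingStatistic hα2 hμ hp hpn P hX hind⟩,
    fun _ hZ hind =>
      HeavyTailPacking.tendstoInProbability_maxPairs_sampleCorr hα2 hμ hp hpn P hZ hind⟩
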